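/- **Theorem 5.1 (Angle-sum Invariant).** Let $\mathcal D$ be a central conic in the Euclidean plane, that is, an ellipse (possibly a circle) or a hyperbola: in suitable Cartesian coordinates it is given by $\frac{x^2}{\alpha}+\frac{y^2}{\beta}=1$ with $\alpha>0$, $\beta\neq 0$, $\beta\le\alpha$, so that its center is the origin and its foci are $(\pm\sqrt{\alpha-\beta},0)$. A nondegenerate triangle is said to be circumscribed about $\mathcal D$ if its three sidelines are tangent to $\mathcal D$. Let $\triangle ABC$ be a nondegenerate triangle circumscribed about $\mathcal D$, and let $\mathcal P$ be the family of all nondegenerate triangles that have the same circumcircle as $\triangle ABC$ and are circumscribed about $\mathcal D$. Then the quantity $$\sin^2 A+\sin^2 B+\sin^2 C,$$ formed with the angles of a triangle, has the same value for all triangles in $\mathcal P$ if and only if the circumcenter of $\triangle ABC$ coincides with the center of $\mathcal D$ or with one of the foci of $\mathcal D$. This holds both under the convention that the asymptotes of a hyperbola count as tangent lines (touching at infinity) and under the convention that they do not. -/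

import Mathlib

open scoped EuclideanGeometry

noncomputable section

/-- The Euclidean plane. -/
abbrev Plane : Type := EuclideanSpace ℝ (Fin 2)

/-- A (nondegenerate) central conic, i.e. an ellipse (possibly a circle) or a hyperbola, in
arbitrary position in the plane. In the Cartesian coordinates `x`, `y` with origin `center` and
orthonormal axes `axes 0`, `axes 1` it has the equation `x² / α + y² / β = 1`. The normalization
`β ≤ α` puts the foci on the first axis; `β > 0` gives the ellipses and `β < 0` the hyperbolas. -/
structure CentralConic where
  center : Plane
  axes : OrthonormalBasis (Fin 2) ℝ Plane
  α : ℝ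
  β : ℝ
  α_pos : 0 < α
  β_ne_zero : β ≠ 0
  β_le_α : β ≤ α

namespace CentralConic

/-- The coordinate along the focal axis. -/
def x (D : CentralConic) (P : Plane) : ℝ := inner ℝ (D.axes 0) (P - D.center)

/-- The coordinate along the other axis. -/
def y (D : CentralConic) (P : Plane) : ℝ := inner ℝ (D.axes 1) (P - D.center)

/-- The points of the conic. -/
def curve (D : CentralConic) : Set Plane := {P | D.x P ^ 2 / D.α + D.y P ^ 2 / D.β = 1}

/-- The linear eccentricity (distance from the center to a focus). -/
def linearEccentricity (D : CentralConic) : ℝ := √(D.α - D.β)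

/-- The two foci (equal to the center when the conic is a circle). -/
def focusPos (D : CentralConic) : Plane := D.center + D.linearEccentricity • D.axes 0

/-- See `focusPos`. -/
def focusNeg (D : CentralConic) : Plane := D.center - D.linearEccentricity • D.axes 0

/-- `ℓ` touches the conic at the point `P` of the conic: `ℓ` is the line with the equation
`x(P) x / α + y(P) y / β = 1`. -/
def IsTangentLineAt (D : CentralConic) (ℓ : AffineSubspace ℝ Plane) (P : Plane) : Prop :=
  P ∈ D.curve ∧ ∀ X : Plane, X ∈ ℓ ↔ D.x P * D.x X / D.α + D.y P * D.y X / D.β = 1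

/-- `ℓ` is an asymptote of the conic: the conic is a hyperbola and `ℓ` is one of the two lines
`y = m x` with `m² = -β / α`. -/
def IsAsymptote (D : CentralConic) (ℓ : AffineSubspace ℝ Plane) : Prop :=
  D.β < 0 ∧ ∃ m : ℝ, m ^ 2 = -D.β / D.α ∧ ∀ X : Plane, X ∈ ℓ ↔ D.y X = m * D.x X

/-- `ℓ` is tangent to the conic. The proposition `asym` fixes the convention: if it is true, then
the asymptotes of a hyperbola count as tangent lines (with a point of contact at infinity); if it
is false, only the lines touching the conic at a point of the plane do. -/
def IsTangentLine (D : CentralConic) (asym : Prop) (ℓ : AffineSubspace ℝ Plane) : Prop :=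
  (∃ P, D.IsTangentLineAt ℓ P) ∨ (asym ∧ D.IsAsymptote ℓ)

/-- The triangle `t` is circumscribed about the conic: its three sidelines are tangent to it. -/
def IsCircumscribed (D : CentralConic) (asym : Prop) (t : Affine.Triangle ℝ Plane) : Prop :=
  ∀ i j : Fin 3, i ≠ j → D.IsTangentLine asym (line[ℝ, t.points i, t.points j])

end CentralConic

/-- `sin² A + sin² B + sin² C` for the angles of a triangle. -/
def sumSinSq (t : Affine.Triangle ℝ Plane) : ℝ :=
  Real.sin (∠ (t.points 1) (t.points 0) (t.points 2)) ^ 2 +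
    Real.sin (∠ (t.points 2) (t.points 1) (t.points 0)) ^ 2 +
    Real.sin (∠ (t.points 0) (t.points 2) (t.points 1)) ^ 2

end

/-! Scale the circumcircle to the unit circle in ℂ, with vertices `z₁, z₂, z₃` and foci `f₁, f₂`. A
line is tangent to the conic, asymptotes included, exactly when the product of the signed distances
of the foci from it is `β`. For a chord of the unit circle this is a polynomial condition on its
endpoints (`isTangentLine_iff_chordForm`).

Put `l = z₁ z₂ z₃`, `F = f₁ + f₂`, `E = f₁ f₂`. By `vertices_of_chordForm_mul` the vertices are the
three solutions of `z (z - f₁)(z - f₂) = l (1 - conj f₁ z)(1 - conj f₂ z)`, so their sum is `F +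
conj E * l`. By the law of sines the sum of squared sines is `(9 - ‖F + conj E * l‖²) / 4`
(`sumSinSq_eq`), where `‖F + conj E * l‖² = ‖F‖² + ‖E‖² + 2 Re (F E conj l)`.

If `F = 0` (circumcenter at the center) or `E = 0` (at a focus), this does not depend on `l`.
Otherwise `exists_deformation` moves one vertex slightly along the circle, solves for the other two,
and changes the value, since equality holds only at the zeros of a nonzero polynomial. -/

open scoped ComplexConjugate Topology

/-! ### Tangent chords of the unit circle and the cubic of the vertices. -/

/-- For `z`, `w` on the unit circle, the equation `chordForm c z w = 0` says that `c` lies on the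
line through `z` and `w`; in general `chordForm c z w / (2 √(z w))` is, up to sign, the signed
distance of `c` from that line. -/
noncomputable def chordForm (c z w : ℂ) : ℂ := c + z * w * conj c - z - w

theorem chordForm_comm (c z w : ℂ) : chordForm c z w = chordForm c w z := by
  unfold chordForm; ring

theorem mul_conj_of_norm_one {z : ℂ} (hz : ‖z‖ = 1) : z * conj z = 1 := by
  rw [Complex.mul_conj, Complex.normSq_eq_norm_sq, hz]; simp

theorem norm_one_of_mul_conj {z : ℂ} (hz : z * conj z = 1) : ‖z‖ = 1 := by
  rw [Complex.mul_conj, Complex.normSq_eq_norm_sq] at hz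
  have h : ‖z‖ ^ 2 = 1 := by exact_mod_cast hz
  exact (pow_eq_one_iff_of_nonneg (norm_nonneg z) two_ne_zero).1 h

/-- Three distinct roots of a monic cubic satisfy Vieta's formulas. -/
theorem vieta_cubic {K : Type*} [Field K] {a b c x y z : K} (hxy : x ≠ y) (hxz : x ≠ z)
    (hyz : y ≠ z) (hx : x ^ 3 - a * x ^ 2 + b * x - c = 0) (hy : y ^ 3 - a * y ^ 2 + b * y - c = 0)
    (hz : z ^ 3 - a * z ^ 2 + b * z - c = 0) :
    x + y + z = a ∧ x * y + x * z + y * z = b := by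
  have h1 : x ^ 2 + x * y + y ^ 2 - a * (x + y) + b = 0 := by
    apply mul_left_cancel₀ (sub_ne_zero.2 hxy); linear_combination hx - hy
  have h2 : x ^ 2 + x * z + z ^ 2 - a * (x + z) + b = 0 := by
    apply mul_left_cancel₀ (sub_ne_zero.2 hxz); linear_combination hx - hz
  have h3 : x + y + z = a := by
    apply mul_left_cancel₀ (sub_ne_zero.2 hyz); linear_combination h1 - h2
  exact ⟨h3, by linear_combination (-1 : K) * h1 + (x + y) * h3⟩

/-- If the three sides of a triangle inscribed in the unit circle are tangent to the same conic
with the foci `f₁`, `f₂`, then the vertices are the roots of a cubic depending only on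
the foci and on the product of the vertices. -/
theorem vertices_of_chordForm_mul {f₁ f₂ k z₁ z₂ z₃ : ℂ} (h₁₂ : z₁ ≠ z₂) (h₁₃ : z₁ ≠ z₃)
    (h₂₃ : z₂ ≠ z₃)
    (t₁₂ : chordForm f₁ z₁ z₂ * chordForm f₂ z₁ z₂ = k * (z₁ * z₂))
    (t₁₃ : chordForm f₁ z₁ z₃ * chordForm f₂ z₁ z₃ = k * (z₁ * z₃))
    (t₂₃ : chordForm f₁ z₂ z₃ * chordForm f₂ z₂ z₃ = k * (z₂ * z₃)) :
    z₁ + z₂ + z₃ = f₁ + f₂ + conj (f₁ * f₂) * (z₁ * z₂ * z₃) ∧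
      z₁ * z₂ + z₁ * z₃ + z₂ * z₃ = f₁ * f₂ + conj (f₁ + f₂) * (z₁ * z₂ * z₃) := by
  -- Eliminate `k` between the two sides through `x` and cancel `y - z`. Multiplied by `x`, the
  -- result is the cubic for `x` with `l = x y z`.
  have key : ∀ x y z : ℂ, y ≠ z → chordForm f₁ x y * chordForm f₂ x y = k * (x * y) →
      chordForm f₁ x z * chordForm f₂ x z = k * (x * z) →
      y * z * ((x * conj f₁ - 1) * (x * conj f₂ - 1)) = (f₁ - x) * (f₂ - x) := by
    intro x y z hyz h h'
    unfold chordForm at h h'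
    apply mul_left_cancel₀ (sub_ne_zero.2 hyz)
    linear_combination z * h - y * h'
  have k₁ := key z₁ z₂ z₃ h₂₃ t₁₂ t₁₃
  have k₂ := key z₂ z₁ z₃ h₁₃ (by rw [chordForm_comm, chordForm_comm f₂, t₁₂]; ring) t₂₃
  have k₃ := key z₃ z₁ z₂ h₁₂ (by rw [chordForm_comm, chordForm_comm f₂, t₁₃]; ring)
    (by rw [chordForm_comm, chordForm_comm f₂, t₂₃]; ring)
  rw [map_mul, map_add]
  refine vieta_cubic (c := z₁ * z₂ * z₃) h₁₂ h₁₃ h₂₃ ?_ ?_ ?_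
  · linear_combination -z₁ * k₁
  · linear_combination -z₂ * k₂
  · linear_combination -z₃ * k₃

/-- The sides of a triangle whose vertices are the roots of the cubic are tangent to the same
conic. -/
theorem chordForm_mul_of_vertices {f₁ f₂ z₁ z₂ z₃ : ℂ}
    (h : z₁ + z₂ + z₃ = f₁ + f₂ + conj (f₁ * f₂) * (z₁ * z₂ * z₃))
    (h' : z₁ * z₂ + z₁ * z₃ + z₂ * z₃ = f₁ * f₂ + conj (f₁ + f₂) * (z₁ * z₂ * z₃)) :
    chordForm f₁ z₁ z₂ * chordForm f₂ z₁ z₂ =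
      (1 - f₁ * conj f₁) * (1 - f₂ * conj f₂) * (z₁ * z₂) := by
  rw [map_mul] at h
  rw [map_add] at h'
  unfold chordForm
  -- Both relations are linear in `z₃`; cross-multiplication eliminates it.
  have a : z₃ * (1 - conj f₁ * conj f₂ * (z₁ * z₂)) = f₁ + f₂ - (z₁ + z₂) := by
    linear_combination h
  have b : z₃ * ((z₁ + z₂) - (conj f₁ + conj f₂) * (z₁ * z₂)) = f₁ * f₂ - z₁ * z₂ := by
    linear_combination h'
  have c : (1 - conj f₁ * conj f₂ * (z₁ * z₂)) * (f₁ * f₂ - z₁ * z₂) =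
      (f₁ + f₂ - (z₁ + z₂)) * ((z₁ + z₂) - (conj f₁ + conj f₂) * (z₁ * z₂)) := by
    rw [← a, ← b]; ring
  linear_combination c

/-- Conjugating the first Vieta relation on the unit circle gives the second. -/
theorem vertices_conj {f₁ f₂ z₁ z₂ z₃ : ℂ} (h₁ : ‖z₁‖ = 1) (h₂ : ‖z₂‖ = 1) (h₃ : ‖z₃‖ = 1)
    (h : z₁ + z₂ + z₃ = f₁ + f₂ + conj (f₁ * f₂) * (z₁ * z₂ * z₃)) :
    z₁ * z₂ + z₁ * z₃ + z₂ * z₃ = f₁ * f₂ + conj (f₁ + f₂) * (z₁ * z₂ * z₃) := by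
  have hc := congrArg conj h
  simp only [map_add, map_mul, Complex.conj_conj] at hc ⊢
  have m₁ := mul_conj_of_norm_one h₁
  have m₂ := mul_conj_of_norm_one h₂
  have m₃ := mul_conj_of_norm_one h₃
  generalize conj z₁ = y₁ at *
  generalize conj z₂ = y₂ at *
  generalize conj z₃ = y₃ at *
  have e : z₁ * y₁ * (z₂ * y₂) * (z₃ * y₃) = 1 := by rw [m₁, m₂, m₃]; ring
  linear_combination (z₁ * z₂ * z₃) * hc - z₂ * z₃ * m₁ - z₁ * z₃ * m₂ - z₁ * z₂ * m₃ + f₁ * f₂ * e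

/-! ### Deforming an inscribed and circumscribed triangle. -/

/-- A quadratic `w² - s w + p` with `|p| = 1`, `s = s̄ p` and `|s| < 2` has two distinct roots on
the unit circle. -/
theorem exists_unit_roots {s p : ℂ} (hp : ‖p‖ = 1) (hs : s = conj s * p) (hs2 : ‖s‖ < 2) :
    ∃ u v : ℂ, ‖u‖ = 1 ∧ ‖v‖ = 1 ∧ u ≠ v ∧ u + v = s ∧ u * v = p := by
  -- With `r² = p`, the substitution `w = r v` gives `v² - t v + 1` with `t` real and `|t| < 2`,
  -- whose roots are `(t ± i √(4 - t²)) / 2`.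
  obtain ⟨r, hr'⟩ := IsAlgClosed.exists_pow_nat_eq p (n := 2) two_pos
  have hr : p = r * r := by rw [← hr', sq]
  have hr1 : ‖r‖ = 1 := by
    have : ‖r‖ * ‖r‖ = 1 := by rw [← norm_mul, ← hr, hp]
    nlinarith [norm_nonneg r]
  have hr0 : r ≠ 0 := by rintro rfl; simp at hr1
  have hrc := mul_conj_of_norm_one hr1
  obtain ⟨t, ht⟩ := Complex.conj_eq_iff_real.1 (show conj (s * conj r) = s * conj r by
    rw [map_mul, Complex.conj_conj]
    linear_combination (-conj s * r) * hrc - conj r * hs - conj s * conj r * hr)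
  have hst : s = t * r := by rw [← ht]; linear_combination (-s) * hrc
  have ht2 : |t| < 2 := by simpa [hst, hr1] using hs2
  have hpos : 0 < 4 - t ^ 2 := by
    have := abs_lt.1 ht2
    nlinarith [this.1, this.2]
  set q : ℝ := √(4 - t ^ 2) with hq
  have hq2 : (q : ℂ) ^ 2 = 4 - t ^ 2 := by exact_mod_cast Real.sq_sqrt hpos.le
  have hq0 : (q : ℂ) ≠ 0 := by exact_mod_cast (Real.sqrt_pos.2 hpos).ne'
  have hI := Complex.I_sq
  refine ⟨r * ((t + q * Complex.I) / 2), r * ((t - q * Complex.I) / 2), ?_, ?_, ?_, ?_, ?_⟩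
  · apply norm_one_of_mul_conj
    simp only [map_mul, map_div₀, map_add, Complex.conj_ofReal, Complex.conj_I, map_ofNat]
    linear_combination (1 : ℂ) * hrc + r * conj r * (hq2 / 4 - q ^ 2 * hI / 4)
  · apply norm_one_of_mul_conj
    simp only [map_mul, map_div₀, map_sub, Complex.conj_ofReal, Complex.conj_I, map_ofNat]
    linear_combination (1 : ℂ) * hrc + r * conj r * (hq2 / 4 - q ^ 2 * hI / 4)
  · intro h
    have h2 := mul_left_cancel₀ hr0 h
    have h3 : (q : ℂ) * Complex.I = 0 := by linear_combination h2
    simp [hq0] at h3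
  · rw [hst]; ring
  · rw [hr]; linear_combination r * r * (hq2 / 4 - q ^ 2 * hI / 4)

theorem norm_add_lt_two {u v : ℂ} (hu : ‖u‖ = 1) (hv : ‖v‖ = 1) (huv : u ≠ v) : ‖u + v‖ < 2 := by
  have h := norm_add_lt_of_not_sameRay (x := u) (y := v)
    (by rwa [sameRay_iff_of_norm_eq (hu.trans hv.symm)])
  rw [hu, hv] at h; linarith

/-- A connected set with more than one point has no isolated points. This leaves room to move a
vertex along the circle while avoiding finitely many values. -/
theorem neBot_nhdsNE_inf_sphere {z : ℂ} (hz : ‖z‖ = 1) :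
    (𝓝[≠] z ⊓ Filter.principal (Metric.sphere (0 : ℂ) 1)).NeBot := by
  have h1 : IsPreconnected (Metric.sphere (0 : ℂ) 1) :=
    isPreconnected_sphere (by simp [Complex.rank_real_complex]) 0 1
  have h2 : (Metric.sphere (0 : ℂ) 1).Nontrivial :=
    ⟨1, by simp, -1, by simp, by norm_num⟩
  exact h1.preperfect_of_nontrivial h2 z (by simpa using hz)

theorem Polynomial.eventually_eval_ne_zero {Q : Polynomial ℂ} (hQ : Q ≠ 0) (z : ℂ) :
    ∀ᶠ w in 𝓝[≠] z, Q.eval w ≠ 0 := by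
  have h : ({w | Q.eval w = 0} : Set ℂ).Finite :=
    Q.roots.toFinset.finite_toSet.subset fun w hw => by simpa [hQ] using hw
  have := (h.subset (Set.sdiff_subset (t := {z}))).isClosed.isOpen_compl.mem_nhds
    (show z ∈ ({w | Q.eval w = 0} \ {z})ᶜ by simp)
  filter_upwards [mem_nhdsWithin_of_mem_nhds this, self_mem_nhdsWithin] with w hw hwz h0
  exact hw ⟨h0, hwz⟩

theorem one_sub_conj_mul_ne_zero {f z : ℂ} (hf : ‖f‖ ≠ 1) (hz : ‖z‖ = 1) :
    1 - conj f * z ≠ 0 := by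
  intro h
  apply hf
  have h' : conj f * z = 1 := by linear_combination -h
  simpa [hz] using congrArg norm h'

/-- A value `z` of the first vertex on the unit circle determines the product `l` of the vertices;
if the remaining quadratic has two further distinct roots on the unit circle, we get a triangle. -/
theorem exists_triangle_of_vertex {f₁ f₂ z l s p : ℂ} (hz : ‖z‖ = 1) (hl : ‖l‖ = 1)
    (hzl : z * (z - f₁) * (z - f₂) = l * ((1 - conj f₁ * z) * (1 - conj f₂ * z)))
    (hp : p = l / z) (hs : s = f₁ + f₂ + conj (f₁ * f₂) * l - z) (hs2 : ‖s‖ < 2)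
    (hne : z ^ 2 - s * z + p ≠ 0) :
    ∃ u v : ℂ, ‖u‖ = 1 ∧ ‖v‖ = 1 ∧ u ≠ v ∧ z ≠ u ∧ z ≠ v ∧ u + v = s ∧ u * v = p := by
  have hz0 : z ≠ 0 := by rintro rfl; simp at hz
  have mz := mul_conj_of_norm_one hz
  have ml := mul_conj_of_norm_one hl
  have hpz : p * z = l := by rw [hp, div_mul_cancel₀ _ hz0]
  have hpc : p = l * conj z := by linear_combination (-p) * mz + conj z * hpz
  -- Dividing the cubic by its root `z` leaves `w² - s w + p`; the symmetry `s = conj s * p` amounts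
  -- to `hzl`.
  obtain ⟨u, v, hu, hv, huv, h1, h2⟩ := exists_unit_roots (s := s) (p := p)
    (by rw [hp, norm_div, hl, hz, div_one]) (by
      apply mul_left_cancel₀ (pow_ne_zero 2 hz0)
      rw [hs, hpc]
      simp only [map_mul, map_add, map_sub, Complex.conj_conj] at *
      linear_combination (-1 : ℂ) * hzl - f₁ * f₂ * z * ml +
        (l - (conj f₁ + conj f₂) * l * z - f₁ * f₂ * z * l * conj l + l * z * conj z) * mz) hs2
  refine ⟨u, v, hu, hv, huv, ?_, ?_, h1, h2⟩
  · rintro rfl; apply hne; linear_combination z * h1 - h2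
  · rintro rfl; apply hne; linear_combination z * h1 - h2

/-- A triangle inscribed in the unit circle and circumscribed about a conic whose center and foci
differ from the origin can be moved to one with another distance of the orthocenter
from the origin. -/
theorem exists_deformation {f₁ f₂ z₁ z₂ z₃ : ℂ} (hz₁ : ‖z₁‖ = 1) (hz₂ : ‖z₂‖ = 1) (hz₃ : ‖z₃‖ = 1)
    (h₁₂ : z₁ ≠ z₂) (h₁₃ : z₁ ≠ z₃) (h₂₃ : z₂ ≠ z₃)
    (h : z₁ + z₂ + z₃ = f₁ + f₂ + conj (f₁ * f₂) * (z₁ * z₂ * z₃))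
    (hf₁ : ‖f₁‖ ≠ 1) (hf₂ : ‖f₂‖ ≠ 1) (hF : f₁ + f₂ ≠ 0) (hE : f₁ * f₂ ≠ 0) (c : ℂ) :
    ∃ w₁ w₂ w₃ : ℂ, ‖w₁‖ = 1 ∧ ‖w₂‖ = 1 ∧ ‖w₃‖ = 1 ∧ w₁ ≠ w₂ ∧ w₁ ≠ w₃ ∧ w₂ ≠ w₃ ∧
      w₁ + w₂ + w₃ = f₁ + f₂ + conj (f₁ * f₂) * (w₁ * w₂ * w₃) ∧
      ‖w₁ + w₂ + w₃‖ ≠ ‖z₁ + z₂ + z₃‖ ∧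
      (chordForm c z₁ z₂ ≠ 0 ∧ chordForm c z₁ z₃ ≠ 0 ∧ chordForm c z₂ z₃ ≠ 0 →
        chordForm c w₁ w₂ ≠ 0 ∧ chordForm c w₁ w₃ ≠ 0 ∧ chordForm c w₂ w₃ ≠ 0) := by
  have h' := vertices_conj hz₁ hz₂ hz₃ h
  have hz₁0 : z₁ ≠ 0 := by rintro rfl; simp at hz₁
  -- Functions of the moving vertex `z`: `l = N / M` is the product of all vertices, while `s` and
  -- `p` are the sum and product of the other two. Since `chordForm c z w = a z + b z * w`, the
  -- condition on both sides through `z` can be written in `s` and `p`.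
  let N : ℂ → ℂ := fun z => z * (z - f₁) * (z - f₂)
  let M : ℂ → ℂ := fun z => (1 - conj f₁ * z) * (1 - conj f₂ * z)
  let l : ℂ → ℂ := fun z => N z / M z
  let p : ℂ → ℂ := fun z => l z / z
  let s : ℂ → ℂ := fun z => f₁ + f₂ + conj (f₁ * f₂) * l z - z
  let a : ℂ → ℂ := fun z => c - z
  let b : ℂ → ℂ := fun z => z * conj c - 1
  have hM : ∀ z, ‖z‖ = 1 → M z ≠ 0 := fun z hz =>
    mul_ne_zero (one_sub_conj_mul_ne_zero hf₁ hz) (one_sub_conj_mul_ne_zero hf₂ hz)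
  have hNl : ∀ z, ‖z‖ = 1 → N z = l z * M z := fun z hz => (div_mul_cancel₀ _ (hM z hz)).symm
  have hlc : ContinuousAt l z₁ := by
    refine ContinuousAt.div ?_ ?_ (hM z₁ hz₁) <;> fun_prop
  have hpc : ContinuousAt p z₁ := hlc.div continuousAt_id hz₁0
  have hsc : ContinuousAt s z₁ := by fun_prop
  have hl₁ : l z₁ = z₁ * z₂ * z₃ := by
    rw [div_eq_iff (hM z₁ hz₁)]
    simp only [map_mul, map_add] at h h'
    simp only [N, M]
    linear_combination z₁ ^ 2 * h - z₁ * h'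
  have hp₁ : p z₁ = z₂ * z₃ := by simp only [p, hl₁]; field_simp
  have hs₁ : s z₁ = z₂ + z₃ := by simp only [s, hl₁]; linear_combination -h
  have e1 : ∀ᶠ z in 𝓝 z₁, ‖s z‖ < 2 :=
    hsc.norm.eventually_lt_const (show ‖s z₁‖ < 2 by rw [hs₁]; exact norm_add_lt_two hz₂ hz₃ h₂₃)
  have e2 : ∀ᶠ z in 𝓝 z₁, z ^ 2 - s z * z + p z ≠ 0 := by
    refine ContinuousAt.eventually_ne (by fun_prop) ?_
    rw [hs₁, hp₁]
    have := mul_ne_zero (sub_ne_zero.2 h₁₂) (sub_ne_zero.2 h₁₃)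
    contrapose! this
    linear_combination this
  have hbc : ContinuousAt b z₁ := by fun_prop
  have e3 : ∀ᶠ z in 𝓝 z₁, (chordForm c z₁ z₂ ≠ 0 ∧ chordForm c z₁ z₃ ≠ 0 ∧ chordForm c z₂ z₃ ≠ 0 →
      c + p z * conj c - s z ≠ 0 ∧ a z ^ 2 + a z * b z * s z + b z ^ 2 * p z ≠ 0) := by
    by_cases hc : chordForm c z₁ z₂ ≠ 0 ∧ chordForm c z₁ z₃ ≠ 0 ∧ chordForm c z₂ z₃ ≠ 0
    · have e4 : ∀ᶠ z in 𝓝 z₁, c + p z * conj c - s z ≠ 0 := by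
        refine ContinuousAt.eventually_ne (by fun_prop) ?_
        rw [hs₁, hp₁]
        convert hc.2.2 using 1
        unfold chordForm; ring
      have e5 : ∀ᶠ z in 𝓝 z₁, a z ^ 2 + a z * b z * s z + b z ^ 2 * p z ≠ 0 := by
        refine ContinuousAt.eventually_ne (by fun_prop) ?_
        rw [hs₁, hp₁]
        convert mul_ne_zero hc.1 hc.2.1 using 1
        simp only [chordForm, a, b]; ring
      filter_upwards [e4, e5] with z h4 h5 _ using ⟨h4, h5⟩
    · exact Filter.Eventually.of_forall fun z hz => absurd hz hc
  -- The condition that the distance of the orthocenter stays the same is algebraic in `z`.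
  let K : ℂ := ((‖z₁ + z₂ + z₃‖ ^ 2 : ℝ) : ℂ) - (f₁ + f₂) * conj (f₁ + f₂) -
    (f₁ * f₂) * conj (f₁ * f₂)
  let Np : Polynomial ℂ := .X * (.X - .C f₁) * (.X - .C f₂)
  let Mp : Polynomial ℂ := (1 - .C (conj f₁) * .X) * (1 - .C (conj f₂) * .X)
  -- An unchanged norm means `K = F E conj l + conj (F E) l`. Multiplying by `N M` and using `l = N
  -- / M`, `l conj l = 1` gives `Q = 0`. At `0`, `N` vanishes and `M = 1`, so `Q` takes the value `F
  -- E ≠ 0`.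
  let Q : Polynomial ℂ := .C ((f₁ + f₂) * (f₁ * f₂)) * Mp ^ 2 +
    .C (conj (f₁ + f₂) * conj (f₁ * f₂)) * Np ^ 2 - .C K * Np * Mp
  have hQ : Q ≠ 0 := by
    intro h0
    have := congrArg (Polynomial.eval 0) h0
    exact mul_ne_zero hF hE (by simpa [Q, Np, Mp] using this)
  have := neBot_nhdsNE_inf_sphere hz₁
  obtain ⟨z, ⟨⟨he, hQz⟩, hz⟩⟩ := Filter.Eventually.exists (f := 𝓝[≠] z₁ ⊓ Filter.principal
      (Metric.sphere (0 : ℂ) 1))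
    ((Filter.Eventually.and (((e1.and (e2.and e3)).filter_mono nhdsWithin_le_nhds).and
      (Polynomial.eventually_eval_ne_zero hQ z₁) |>.filter_mono inf_le_left)
      (Filter.mem_inf_of_right (Filter.mem_principal_self _))))
  obtain ⟨h1, h2, h3⟩ := he
  have hz : ‖z‖ = 1 := by simpa using hz
  have mz := mul_conj_of_norm_one hz
  have hz0 : z ≠ 0 := by rintro rfl; simp at hz
  have hl : ‖l z‖ = 1 := by
    have hcM : conj (M z) * z ^ 3 = N z := by
      simp only [M, N, map_mul, map_sub, map_one, Complex.conj_conj]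
      linear_combination (z * (-z * f₁ - z * f₂ + f₁ * f₂ * (z * conj z + 1))) * mz
    have : ‖M z‖ = ‖N z‖ := by rw [← hcM]; simp [hz]
    rw [norm_div, ← this, div_self (norm_ne_zero_iff.2 (hM z hz))]
  obtain ⟨u, v, hu, hv, huv, hzu, hzv, hsum, hprod⟩ : ∃ u v : ℂ, ‖u‖ = 1 ∧ ‖v‖ = 1 ∧ u ≠ v ∧
      z ≠ u ∧ z ≠ v ∧ u + v = s z ∧ u * v = p z :=
    exists_triangle_of_vertex hz hl (hNl z hz) rfl rfl h1 h2
  have hprod' : z * u * v = l z := by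
    rw [mul_assoc, hprod]; exact mul_div_cancel₀ _ hz0
  have hsum' : z + u + v = f₁ + f₂ + conj (f₁ * f₂) * l z := by
    simp only [s] at hsum; linear_combination hsum
  refine ⟨z, u, v, hz, hu, hv, hzu, hzv, huv, by rw [hsum', hprod'], ?_, ?_⟩
  · intro hn
    apply hQz
    have hn2 : (z + u + v) * conj (z + u + v) = ((‖z₁ + z₂ + z₃‖ ^ 2 : ℝ) : ℂ) := by
      rw [Complex.mul_conj, Complex.normSq_eq_norm_sq, hn]
    have ml := mul_conj_of_norm_one hl
    have hK : K = ((f₁ + f₂) * (f₁ * f₂)) * conj (l z) +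
        (conj (f₁ + f₂) * conj (f₁ * f₂)) * l z := by
      simp only [K]
      rw [← hn2, hsum']
      simp only [map_mul, map_add, Complex.conj_conj]
      linear_combination (conj f₁ * conj f₂ * f₁ * f₂) * ml
    have : Q.eval z = (f₁ + f₂) * (f₁ * f₂) * M z ^ 2 +
        (conj (f₁ + f₂) * conj (f₁ * f₂)) * N z ^ 2 - K * N z * M z := by
      simp [Q, Np, Mp, M, N]
    rw [this, hNl z hz, hK]
    linear_combination (-(f₁ + f₂) * (f₁ * f₂) * M z ^ 2) * ml
  · intro hc
    obtain ⟨h4, h5⟩ := h3 hc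
    rw [← hsum, ← hprod] at h4 h5
    have h6 : chordForm c z u * chordForm c z v ≠ 0 := by
      convert h5 using 1
      simp only [chordForm, a, b]; ring
    refine ⟨left_ne_zero_of_mul h6, right_ne_zero_of_mul h6, ?_⟩
    convert h4 using 1
    unfold chordForm; ring

/-! ### Cartesian coordinates and tangency of a line through two points. -/

namespace CentralConic

/-- The linear isometry onto the complex plane which takes the axes to the real and imaginary
axis. -/
noncomputable def toComplex (D : CentralConic) : Plane ≃ₗᵢ[ℝ] ℂ :=
  D.axes.repr.trans Complex.orthonormalBasisOneI.repr.symm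

/-- The Cartesian coordinates as a complex number. -/
noncomputable def coord (D : CentralConic) (P : Plane) : ℂ := D.toComplex (P - D.center)

variable (D : CentralConic) (P Q X : Plane)

theorem coord_eq : D.coord P = ⟨D.x P, D.y P⟩ := by
  apply Complex.ext <;>
  simp [coord, toComplex, x, y, ← OrthonormalBasis.sum_repr_symm, OrthonormalBasis.repr_apply_apply,
    inner_sub_right]

@[simp] theorem coord_re : (D.coord P).re = D.x P := by rw [coord_eq]

@[simp] theorem coord_im : (D.coord P).im = D.y P := by rw [coord_eq]

theorem coord_sub : D.coord P - D.coord Q = D.toComplex (P - Q) := by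
  simp [coord]

theorem norm_coord_sub : ‖D.coord P - D.coord Q‖ = dist P Q := by
  rw [coord_sub, LinearIsometryEquiv.norm_map, dist_eq_norm]

variable {P Q} in
theorem coord_inj : D.coord P = D.coord Q ↔ P = Q := by
  simp [coord]

theorem coord_surjective : Function.Surjective D.coord := fun w =>
  ⟨D.toComplex.symm w + D.center, by simp [coord]⟩

theorem coord_lineMap (r : ℝ) :
    D.coord (AffineMap.lineMap P Q r) = (1 - r) * D.coord P + r * D.coord Q := by
  simp only [coord, AffineMap.lineMap_apply, vsub_eq_sub, vadd_eq_add, map_sub, map_add, map_smul,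
    Complex.real_smul]
  ring

theorem coord_center : D.coord D.center = 0 := by simp [coord]

theorem toComplex_axes_zero : D.toComplex (D.axes 0) = 1 := by
  simp [toComplex]

theorem coord_focusPos : D.coord D.focusPos = D.linearEccentricity := by
  simp [coord, focusPos, toComplex_axes_zero]

theorem coord_focusNeg : D.coord D.focusNeg = -D.linearEccentricity := by
  simp [coord, focusNeg, toComplex_axes_zero]

theorem linearEccentricity_sq : D.linearEccentricity ^ 2 = D.α - D.β :=
  Real.sq_sqrt (sub_nonneg.2 D.β_le_α)

variable {P Q} in
theorem mem_line_iff (hPQ : P ≠ Q) : X ∈ line[ℝ, P, Q] ↔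
    (D.y Q - D.y P) * D.x X + (D.x P - D.x Q) * D.y X = D.x P * D.y Q - D.x Q * D.y P := by
  rw [mem_affineSpan_pair_iff_exists_lineMap_eq]
  constructor
  · rintro ⟨r, rfl⟩
    have h := D.coord_lineMap P Q r
    have hx : D.x (AffineMap.lineMap P Q r) = (1 - r) * D.x P + r * D.x Q := by
      simpa using congrArg Complex.re h
    have hy : D.y (AffineMap.lineMap P Q r) = (1 - r) * D.y P + r * D.y Q := by
      simpa using congrArg Complex.im h
    rw [hx, hy]; ring
  · intro h
    set u := D.x Q - D.x P with hu
    set v := D.y Q - D.y P with hv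
    have hne : u ^ 2 + v ^ 2 ≠ 0 := by
      intro h0
      apply hPQ
      rw [← D.coord_inj]
      apply Complex.ext <;> simp only [coord_re, coord_im] <;> nlinarith
    refine ⟨((D.x X - D.x P) * u + (D.y X - D.y P) * v) / (u ^ 2 + v ^ 2), ?_⟩
    rw [← D.coord_inj, coord_lineMap]
    apply Complex.ext <;> simp [-Complex.ofReal_div] <;> field_simp
    · linear_combination (-v) * h
    · linear_combination u * h

/-- For the line `a x + b y = c` the criterion is `c² = α a² + β b²`. If `c ≠ 0`, the point of
contact is `(α a / c, β b / c)`. If `c = 0`, the equation forces `β < 0` and the line is an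
asymptote. -/
theorem isTangentLine_iff (asym : Prop) {P Q : Plane} (hPQ : P ≠ Q) :
    D.IsTangentLine asym line[ℝ, P, Q] ↔
      (D.x P * D.y Q - D.x Q * D.y P) ^ 2 =
        D.α * (D.y Q - D.y P) ^ 2 + D.β * (D.x P - D.x Q) ^ 2 ∧
      (asym ∨ D.x P * D.y Q - D.x Q * D.y P ≠ 0) := by
  have hα := D.α_pos.ne'
  have hβ := D.β_ne_zero
  have hne : ¬ (D.y Q - D.y P = 0 ∧ D.x P - D.x Q = 0) := by
    rintro ⟨h1, h2⟩
    apply hPQ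
    rw [← D.coord_inj]
    apply Complex.ext <;> simp only [coord_re, coord_im] <;> linarith
  have hline := fun X => D.mem_line_iff X hPQ
  have hP := left_mem_affineSpan_pair ℝ P Q
  have hQ := right_mem_affineSpan_pair ℝ P Q
  constructor
  · rintro (⟨T, hT, h⟩ | ⟨ha, hβ0, m, hm, h⟩)
    · rw [h] at hP hQ
      simp only [curve, Set.mem_ofPred_eq] at hT
      obtain ⟨a, ha⟩ : ∃ a, D.x T = D.α * a := ⟨D.x T / D.α, by field_simp⟩
      obtain ⟨b, hb⟩ : ∃ b, D.y T = D.β * b := ⟨D.y T / D.β, by field_simp⟩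
      rw [ha, hb] at hT hP hQ
      have hT : D.α * a ^ 2 + D.β * b ^ 2 = 1 := by rw [← hT]; field_simp
      have hP : a * D.x P + b * D.y P = 1 := by rw [← hP]; field_simp
      have hQ : a * D.x Q + b * D.y Q = 1 := by rw [← hQ]; field_simp
      have h1 : D.y Q - D.y P = a * (D.x P * D.y Q - D.x Q * D.y P) := by
        linear_combination D.y P * hQ - D.y Q * hP
      have h2 : D.x P - D.x Q = b * (D.x P * D.y Q - D.x Q * D.y P) := by
        linear_combination D.x Q * hP - D.x P * hQ
      refine ⟨?_, .inr fun h0 => hne ?_⟩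
      · rw [h1, h2]; linear_combination (-(D.x P * D.y Q - D.x Q * D.y P) ^ 2) * hT
      · rw [h1, h2, h0]; simp
    · rw [h] at hP hQ
      refine ⟨?_, .inl ha⟩
      rw [hP, hQ]
      have : D.α * m ^ 2 + D.β = 0 := by rw [hm]; field_simp; ring
      linear_combination (-(D.x P - D.x Q) ^ 2) * this
  · rintro ⟨h, ha⟩
    by_cases hd : D.x P * D.y Q - D.x Q * D.y P = 0
    · refine .inr ⟨ha.resolve_right (not_not.2 hd), ?_⟩
      rw [hd] at h
      have hn : D.x P - D.x Q ≠ 0 := by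
        intro h0
        rw [h0] at h
        exact hne ⟨by simpa [hα] using h.symm, h0⟩
      have hn2 : 0 < (D.x P - D.x Q) ^ 2 := by positivity
      have hβ0 : D.β < 0 := by
        refine lt_of_le_of_ne ?_ hβ
        have : 0 ≤ D.α * (D.y Q - D.y P) ^ 2 := mul_nonneg D.α_pos.le (sq_nonneg _)
        by_contra hcon
        nlinarith [mul_pos (not_le.1 hcon) hn2]
      refine ⟨hβ0, -(D.y Q - D.y P) / (D.x P - D.x Q), ?_, fun X => ?_⟩
      · field_simp; linear_combination -h
      · rw [D.mem_line_iff X hPQ, hd, div_mul_eq_mul_div, eq_div_iff hn]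
        constructor <;> intro h' <;> linear_combination h'
    · refine .inl ?_
      generalize D.x P * D.y Q - D.x Q * D.y P = d at *
      obtain ⟨T, hT⟩ := D.coord_surjective
        ⟨D.α * ((D.y Q - D.y P) / d), D.β * ((D.x P - D.x Q) / d)⟩
      have hx := congrArg Complex.re hT
      have hy := congrArg Complex.im hT
      simp only [coord_re, coord_im] at hx hy
      refine ⟨T, ?_, fun X => ?_⟩
      · simp only [curve, Set.mem_ofPred_eq, hx, hy]
        field_simp
        linear_combination -h
      · rw [hline X, hx, hy, ← div_eq_one_iff_eq hd]
        field_simp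

/-! ### Tangency after scaling the circumcircle to the unit circle. -/

/-- The image of a point under the similarity onto the complex plane which takes the circle with
center `O` and radius `R` to the unit circle. -/
noncomputable def unitCoord (O : Plane) (R : ℝ) (P : Plane) : ℂ := (D.coord P - D.coord O) / R

variable {O : Plane} {R : ℝ}

theorem norm_unitCoord_sub (hR : 0 < R) :
    ‖D.unitCoord O R P - D.unitCoord O R Q‖ = dist P Q / R := by
  rw [unitCoord, unitCoord, ← sub_div, sub_sub_sub_cancel_right, norm_div, norm_coord_sub,
    Complex.norm_real, Real.norm_of_nonneg hR.le]

theorem unitCoord_self : D.unitCoord O R O = 0 := by simp [unitCoord]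

theorem norm_unitCoord (hR : 0 < R) : ‖D.unitCoord O R P‖ = dist P O / R := by
  rw [← D.norm_unitCoord_sub P O hR (O := O), unitCoord_self, sub_zero]

variable {P Q} in
theorem unitCoord_inj (hR : 0 < R) : D.unitCoord O R P = D.unitCoord O R Q ↔ P = Q := by
  rw [← sub_eq_zero, ← norm_eq_zero, D.norm_unitCoord_sub P Q hR]
  simp [hR.ne']

theorem unitCoord_surjective (hR : 0 < R) : Function.Surjective (D.unitCoord O R) := fun w => by
  obtain ⟨P, hP⟩ := D.coord_surjective (R * w + D.coord O)
  have : (R : ℂ) ≠ 0 := by exact_mod_cast hR.ne'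
  exact ⟨P, by rw [unitCoord, hP]; field_simp; ring⟩

/-- The chord form of a real multiple of the focal axis. -/
theorem chordForm_unitCoord (hR : 0 < R) {F : Plane} {a : ℝ} (hF : D.coord F = a)
    (hP : ‖D.unitCoord O R P‖ = 1) (hQ : ‖D.unitCoord O R Q‖ = 1) :
    R ^ 2 * ((D.unitCoord O R Q - D.unitCoord O R P) *
        chordForm (D.unitCoord O R F) (D.unitCoord O R P) (D.unitCoord O R Q)) =
      -(D.unitCoord O R P * D.unitCoord O R Q) * (2 * Complex.I *
        ((D.x P * D.y Q - D.x Q * D.y P - a * (D.y Q - D.y P) : ℝ) : ℂ)) := by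
  have hR0 : (R : ℂ) ≠ 0 := by exact_mod_cast hR.ne'
  have mP := mul_conj_of_norm_one hP
  have mQ := mul_conj_of_norm_one hQ
  have hc : ∀ S, D.coord S = D.coord O + R * D.unitCoord O R S := fun S => by
    rw [unitCoord]; field_simp; ring
  -- Up to sign, the real factor is twice the signed area of `F P Q`. On the unit circle `conj z = 1
  -- / z` makes it polynomial in the endpoints.
  have key : (2 * Complex.I * ((D.x P * D.y Q - D.x Q * D.y P - a * (D.y Q - D.y P) : ℝ) : ℂ)) =
      (D.coord F - D.coord P) * conj (D.coord Q - D.coord P) -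
        conj (D.coord F - D.coord P) * (D.coord Q - D.coord P) := by
    rw [hF]
    apply Complex.ext <;> simp <;> ring
  rw [key, hc P, hc Q, hc F]
  simp only [chordForm, map_add, map_sub, map_mul, Complex.conj_ofReal]
  generalize D.unitCoord O R P = z at *
  generalize D.unitCoord O R Q = w at *
  generalize D.unitCoord O R F = f at *
  linear_combination (R : ℂ) ^ 2 * (w * (w - f)) * mP + R ^ 2 * (z * (f - z)) * mQ

end CentralConic

namespace CentralConic

variable (D : CentralConic) {O : Plane} {R : ℝ}

/-- With `e² = α - β`, the criterion `c² = α a² + β b²` becomes `(c - e a)(c + e a) = β (a² + b²)`.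
The factors on the left are the chord forms of the foci, and `a² + b²` is the squared chord length,
up to nonzero factors. The last clause excludes lines through the center, the only possible
asymptotes. -/
theorem isTangentLine_iff_chordForm (asym : Prop) (hR : 0 < R) {P Q : Plane} (hPQ : P ≠ Q)
    (hP : ‖D.unitCoord O R P‖ = 1) (hQ : ‖D.unitCoord O R Q‖ = 1) :
    D.IsTangentLine asym line[ℝ, P, Q] ↔
      chordForm (D.unitCoord O R D.focusPos) (D.unitCoord O R P) (D.unitCoord O R Q) *
        chordForm (D.unitCoord O R D.focusNeg) (D.unitCoord O R P) (D.unitCoord O R Q) =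
          4 * D.β / R ^ 2 * (D.unitCoord O R P * D.unitCoord O R Q) ∧
      (asym ∨
        chordForm (D.unitCoord O R D.center) (D.unitCoord O R P) (D.unitCoord O R Q) ≠ 0) := by
  have hR0 : (R : ℂ) ≠ 0 := by exact_mod_cast hR.ne'
  have hzw := sub_ne_zero.2 ((D.unitCoord_inj hR (O := O)).not.2 hPQ.symm)
  have hz0 : D.unitCoord O R P ≠ 0 := by rw [← norm_ne_zero_iff, hP]; exact one_ne_zero
  have hw0 : D.unitCoord O R Q ≠ 0 := by rw [← norm_ne_zero_iff, hQ]; exact one_ne_zero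
  have mP := mul_conj_of_norm_one hP
  have mQ := mul_conj_of_norm_one hQ
  have h₁ := D.chordForm_unitCoord P Q hR D.coord_focusPos hP hQ
  have h₂ := D.chordForm_unitCoord P Q hR (a := -D.linearEccentricity)
    (by rw [coord_focusNeg]; simp) hP hQ
  have h₀ := D.chordForm_unitCoord P Q hR (a := 0) (by rw [coord_center]; simp) hP hQ
  have hd : (R : ℂ) ^ 2 * (D.unitCoord O R Q - D.unitCoord O R P) ^ 2 =
      -(D.unitCoord O R P * D.unitCoord O R Q) *
        (((D.y Q - D.y P) ^ 2 + (D.x P - D.x Q) ^ 2 : ℝ) : ℂ) := by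
    have e : (((D.y Q - D.y P) ^ 2 + (D.x P - D.x Q) ^ 2 : ℝ) : ℂ) =
        R ^ 2 * ((D.unitCoord O R Q - D.unitCoord O R P) *
          conj (D.unitCoord O R Q - D.unitCoord O R P)) := by
      have : (R : ℂ) * (D.unitCoord O R Q - D.unitCoord O R P) = D.coord Q - D.coord P := by
        simp only [unitCoord]; field_simp; ring
      have hc : ((R : ℂ) * (D.unitCoord O R Q - D.unitCoord O R P)) *
          conj ((R : ℂ) * (D.unitCoord O R Q - D.unitCoord O R P)) =
          (((D.y Q - D.y P) ^ 2 + (D.x P - D.x Q) ^ 2 : ℝ) : ℂ) := by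
        rw [this, Complex.mul_conj, Complex.normSq_apply]
        congr 1; simp; ring
      rw [← hc, map_mul, Complex.conj_ofReal]; ring
    rw [e, map_sub]
    linear_combination (R : ℂ) ^ 2 * (D.unitCoord O R Q - D.unitCoord O R P) *
      (D.unitCoord O R P * mQ - D.unitCoord O R Q * mP)
  rw [D.isTangentLine_iff asym hPQ]
  generalize D.unitCoord O R P = z at *
  generalize D.unitCoord O R Q = w at *
  refine and_congr ?_ (or_congr_right (not_congr ?_))
  · have hI := Complex.I_sq
    have hc := D.linearEccentricity_sq
    generalize chordForm (D.unitCoord O R D.focusPos) z w = A at *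
    generalize chordForm (D.unitCoord O R D.focusNeg) z w = B at *
    have key : (R : ℂ) ^ 4 * (w - z) ^ 2 * (A * B - 4 * D.β / R ^ 2 * (z * w)) =
        -4 * (z * w) ^ 2 * (((D.x P * D.y Q - D.x Q * D.y P) ^ 2 -
          (D.α * (D.y Q - D.y P) ^ 2 + D.β * (D.x P - D.x Q) ^ 2) : ℝ) : ℂ) := by
      have e : (R : ℂ) ^ 4 * (w - z) ^ 2 * (A * B - 4 * D.β / R ^ 2 * (z * w)) =
          (R ^ 2 * ((w - z) * A)) * (R ^ 2 * ((w - z) * B)) -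
            4 * D.β * (z * w) * (R ^ 2 * (w - z) ^ 2) := by
        field_simp
      rw [e, h₁, h₂, hd]
      have hc' : (D.linearEccentricity : ℂ) ^ 2 = D.α - D.β := by exact_mod_cast hc
      push_cast
      linear_combination 4 * (z * w) ^ 2 * ((D.x P * D.y Q - D.x Q * D.y P) ^ 2 -
        (D.α - D.β) * (D.y Q - D.y P) ^ 2 : ℂ) * hI -
        4 * Complex.I ^ 2 * (z * w) ^ 2 * (D.y Q - D.y P : ℂ) ^ 2 * hc'
    rw [← sub_eq_zero (a := A * B), ← mul_eq_zero_iff_left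
      (mul_ne_zero (pow_ne_zero 4 hR0) (pow_ne_zero 2 hzw)), key,
      mul_eq_zero_iff_left (mul_ne_zero (by norm_num) (pow_ne_zero 2 (mul_ne_zero hz0 hw0))),
      Complex.ofReal_eq_zero, sub_eq_zero]
  · rw [← mul_eq_zero_iff_left hzw, ← mul_eq_zero_iff_left (pow_ne_zero 2 hR0), h₀,
      mul_eq_zero_iff_left (neg_ne_zero.2 (mul_ne_zero hz0 hw0)),
      mul_eq_zero_iff_left (mul_ne_zero two_ne_zero Complex.I_ne_zero), Complex.ofReal_eq_zero,
      zero_mul, sub_zero]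

theorem isCircumscribed_iff (asym : Prop) (t : Affine.Triangle ℝ Plane) :
    D.IsCircumscribed asym t ↔ D.IsTangentLine asym line[ℝ, t.points 0, t.points 1] ∧
      D.IsTangentLine asym line[ℝ, t.points 0, t.points 2] ∧
      D.IsTangentLine asym line[ℝ, t.points 1, t.points 2] := by
  refine ⟨fun h => ⟨h 0 1 (by decide), h 0 2 (by decide), h 1 2 (by decide)⟩, ?_⟩
  rintro ⟨h₁, h₂, h₃⟩ i j hij
  fin_cases i <;> fin_cases j <;> first
    | exact absurd rfl hij
    | assumption
    | (rw [Set.pair_comm]; assumption)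

/-- A circumscribed triangle in terms of the vertices on the unit circle. -/
theorem isCircumscribed_iff_chordForm (asym : Prop) (hR : 0 < R) (t : Affine.Triangle ℝ Plane)
    {z : Fin 3 → ℂ} (hz : ∀ i, D.unitCoord O R (t.points i) = z i) (hz1 : ∀ i, ‖z i‖ = 1) :
    D.IsCircumscribed asym t ↔
      (∀ i j : Fin 3, i < j → chordForm (D.unitCoord O R D.focusPos) (z i) (z j) *
        chordForm (D.unitCoord O R D.focusNeg) (z i) (z j) = 4 * D.β / R ^ 2 * (z i * z j)) ∧
      (asym ∨ chordForm (D.unitCoord O R D.center) (z 0) (z 1) ≠ 0 ∧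
        chordForm (D.unitCoord O R D.center) (z 0) (z 2) ≠ 0 ∧
        chordForm (D.unitCoord O R D.center) (z 1) (z 2) ≠ 0) := by
  have h : ∀ i j : Fin 3, i ≠ j → _ := fun i j hij =>
    D.isTangentLine_iff_chordForm asym hR (O := O) (t.independent.injective.ne hij)
      (by rw [hz, hz1]) (by rw [hz, hz1])
  simp only [hz] at h
  rw [isCircumscribed_iff, h 0 1 (by decide), h 0 2 (by decide), h 1 2 (by decide)]
  have : ∀ p : Fin 3 → Fin 3 → Prop, (∀ i j, i < j → p i j) ↔ p 0 1 ∧ p 0 2 ∧ p 1 2 := by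
    intro p
    simp [Fin.forall_fin_succ]
    tauto
  rw [this (fun i j => chordForm (D.unitCoord O R D.focusPos) (z i) (z j) *
        chordForm (D.unitCoord O R D.focusNeg) (z i) (z j) = 4 * D.β / R ^ 2 * (z i * z j))]
  tauto

theorem unitCoord_center_add :
    D.unitCoord O R D.focusPos + D.unitCoord O R D.focusNeg = 2 * D.unitCoord O R D.center := by
  simp only [unitCoord, coord_focusPos, coord_focusNeg, coord_center]; ring

end CentralConic

/-! ### Squared sines, and triangles with a prescribed circumcircle. -/

theorem sq_norm_sub_add_sq_norm_sum {a b c : ℂ} (ha : ‖a‖ = 1) (hb : ‖b‖ = 1) (hc : ‖c‖ = 1) :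
    ‖b - c‖ ^ 2 + ‖c - a‖ ^ 2 + ‖a - b‖ ^ 2 = 9 - ‖a + b + c‖ ^ 2 := by
  have h : ∀ u : ℂ, ‖u‖ ^ 2 = u.re * u.re + u.im * u.im := fun u => by
    rw [Complex.sq_norm, Complex.normSq_apply]
  have ha' := h a
  have hb' := h b
  have hc' := h c
  rw [ha] at ha'
  rw [hb] at hb'
  rw [hc] at hc'
  simp only [h, Complex.add_re, Complex.sub_re, Complex.add_im, Complex.sub_im]
  linear_combination -3 * ha' - 3 * hb' - 3 * hc'

theorem Affine.Triangle.sin_angle_eq (t : Affine.Triangle ℝ Plane) {i j k : Fin 3} (hij : i ≠ j)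
    (hik : i ≠ k) (hjk : j ≠ k) : Real.sin (∠ (t.points i) (t.points j) (t.points k)) =
      dist (t.points i) (t.points k) / t.circumradius / 2 := by
  have h := t.dist_div_sin_angle_eq_two_mul_circumradius hij hik hjk
  have hR := t.circumradius_pos
  have hs : Real.sin (∠ (t.points i) (t.points j) (t.points k)) ≠ 0 := by
    intro h0; rw [h0, div_zero] at h; linarith
  rw [div_eq_iff hs] at h
  rw [h]; field_simp

/-- By the law of sines each sine is half of a side of the scaled triangle. The sum of the vertices
is its orthocenter, so only the distance from orthocenter to circumcenter matters. -/
theorem sumSinSq_eq (D : CentralConic) (t : Affine.Triangle ℝ Plane) {z : Fin 3 → ℂ}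
    (hz : ∀ i, D.unitCoord t.circumcenter t.circumradius (t.points i) = z i)
    (hz1 : ∀ i, ‖z i‖ = 1) : sumSinSq t = (9 - ‖z 0 + z 1 + z 2‖ ^ 2) / 4 := by
  rw [sumSinSq, t.sin_angle_eq (by decide) (by decide) (by decide),
    t.sin_angle_eq (by decide) (by decide) (by decide),
    t.sin_angle_eq (by decide) (by decide) (by decide),
    ← sq_norm_sub_add_sq_norm_sum (hz1 0) (hz1 1) (hz1 2)]
  simp only [← D.norm_unitCoord_sub _ _ t.circumradius_pos (O := t.circumcenter), hz]
  ring

theorem norm_unitCoord_points (D : CentralConic) (t : Affine.Triangle ℝ Plane) (i : Fin 3) :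
    ‖D.unitCoord t.circumcenter t.circumradius (t.points i)‖ = 1 := by
  rw [D.norm_unitCoord _ t.circumradius_pos, t.dist_circumcenter_eq_circumradius,
    div_self t.circumradius_pos.ne']

/-- Distinct points of a circle in the plane form a triangle with this circumcircle. -/
theorem exists_triangle_circumsphere (S : EuclideanGeometry.Sphere Plane) {p : Fin 3 → Plane}
    (hp : ∀ i, p i ∈ S) (h₁₂ : p 0 ≠ p 1) (h₁₃ : p 0 ≠ p 2) (h₂₃ : p 1 ≠ p 2) :
    ∃ s : Affine.Triangle ℝ Plane, s.circumsphere = S ∧ s.points = p := by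
  have hp' : p = ![p 0, p 1, p 2] := by ext i : 1; fin_cases i <;> rfl
  have hind : AffineIndependent ℝ p := by
    rw [hp']
    exact EuclideanGeometry.Cospherical.affineIndependent_of_ne
      ⟨S.center, S.radius, by simpa using ⟨hp 0, hp 1, hp 2⟩⟩ h₁₂ h₁₃ h₂₃
  refine ⟨⟨p, hind⟩, ?_, rfl⟩
  refine ((Affine.Simplex.circumsphere_unique_dist_eq (⟨p, hind⟩ : Affine.Triangle ℝ Plane)).2 S
    ⟨?_, ?_⟩).symm
  · have : affineSpan ℝ (Set.range p) = ⊤ := hind.affineSpan_eq_top_iff_card_eq_finrank_add_one.2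
      (by simp)
    simp [this]
  · rintro _ ⟨i, rfl⟩
    exact hp i

/-! ### The equivalence. -/

theorem theorem5p1 (asym : Prop) (D : CentralConic) (t : Affine.Triangle ℝ Plane)
    (ht : D.IsCircumscribed asym t) :
    (∃ k : ℝ, ∀ s : Affine.Triangle ℝ Plane,
        s.circumsphere = t.circumsphere → D.IsCircumscribed asym s → sumSinSq s = k) ↔
      (t.circumcenter = D.center ∨ t.circumcenter = D.focusPos ∨ t.circumcenter = D.focusNeg) := by
  have hR := t.circumradius_pos
  set O := t.circumcenter
  set R := t.circumradius
  have hcoord : ∀ P, O = P ↔ D.unitCoord O R P = 0 := fun P => by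
    rw [← D.unitCoord_self (O := O) (R := R), D.unitCoord_inj hR, eq_comm]
  have hFc := D.unitCoord_center_add (O := O) (R := R)
  -- The position condition becomes `F = 0 ∨ E = 0`.
  rw [hcoord, hcoord, hcoord, ← mul_eq_zero, ← mul_eq_zero_iff_left (a := (2 : ℂ)) two_ne_zero,
    ← hFc]
  have hrel : ∀ s : Affine.Triangle ℝ Plane, s.circumsphere = t.circumsphere →
      D.IsCircumscribed asym s → ∃ z : Fin 3 → ℂ, (∀ i, D.unitCoord O R (s.points i) = z i) ∧
        (∀ i, ‖z i‖ = 1) ∧ Function.Injective z ∧ sumSinSq s = (9 - ‖z 0 + z 1 + z 2‖ ^ 2) / 4 ∧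
        z 0 + z 1 + z 2 = D.unitCoord O R D.focusPos + D.unitCoord O R D.focusNeg +
          conj (D.unitCoord O R D.focusPos * D.unitCoord O R D.focusNeg) *
            (z 0 * z 1 * z 2) := by
    intro s hs hD
    have h1 : s.circumcenter = O := congrArg EuclideanGeometry.Sphere.center hs
    have h2 : s.circumradius = R := congrArg EuclideanGeometry.Sphere.radius hs
    have hn := norm_unitCoord_points D s
    have hsum := sumSinSq_eq D s (fun i => rfl) hn
    rw [h1, h2] at hn hsum
    have hinj : Function.Injective fun i => D.unitCoord O R (s.points i) := fun i j hij =>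
      s.independent.injective ((D.unitCoord_inj hR).1 hij)
    refine ⟨fun i => D.unitCoord O R (s.points i), fun i => rfl, hn, hinj, hsum, ?_⟩
    have hT := ((D.isCircumscribed_iff_chordForm asym hR s (fun i => rfl) hn).1 hD).1
    exact (vertices_of_chordForm_mul (hinj.ne (by decide)) (hinj.ne (by decide))
      (hinj.ne (by decide)) (hT 0 1 (by decide)) (hT 0 2 (by decide)) (hT 1 2 (by decide))).1
  constructor
  · rintro ⟨k, hk⟩
    obtain ⟨z, hz, hz1, hinj, hsum, hv⟩ := hrel t rfl ht
    obtain ⟨hT, has⟩ := (D.isCircumscribed_iff_chordForm asym hR t hz hz1).1 ht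
    have hz0 : ∀ i, z i ≠ 0 := fun i => by rw [← norm_ne_zero_iff, hz1]; exact one_ne_zero
    -- The given triangle forces `4 β / R² = (1 - ‖f₁‖²)(1 - ‖f₂‖²)`. As `β ≠ 0`, no focus lies on
    -- the circumcircle; the same identity makes the deformed triangle tangent to the same conic.
    have hβ := (mul_right_cancel₀ (mul_ne_zero (hz0 0) (hz0 1)) ((hT 0 1 (by decide)).symm.trans
      (chordForm_mul_of_vertices hv (vertices_conj (hz1 0) (hz1 1) (hz1 2) hv))))
    have hβ0 : 4 * (D.β : ℂ) / R ^ 2 ≠ 0 := by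
      have h₁ : (R : ℂ) ≠ 0 := by exact_mod_cast hR.ne'
      have h₂ : (D.β : ℂ) ≠ 0 := by exact_mod_cast D.β_ne_zero
      exact div_ne_zero (mul_ne_zero (by norm_num) h₂) (pow_ne_zero 2 h₁)
    by_contra! hcon
    have hf : ∀ f : ℂ, 1 - f * conj f ≠ 0 → ‖f‖ ≠ 1 := fun f h h' =>
      h (by rw [mul_conj_of_norm_one h', sub_self])
    have hne := hβ ▸ hβ0
    -- Taking the center for `c` keeps the new sidelines off the center if the old ones were, so
    -- both conventions for asymptotes are covered.
    obtain ⟨w₁, w₂, w₃, hw₁, hw₂, hw₃, h₁₂, h₁₃, h₂₃, hw, hnorm, hnd⟩ :=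
      exists_deformation (hz1 0) (hz1 1) (hz1 2) (hinj.ne (by decide)) (hinj.ne (by decide))
        (hinj.ne (by decide)) hv (hf _ (left_ne_zero_of_mul hne)) (hf _ (right_ne_zero_of_mul hne))
        hcon.1 hcon.2 (D.unitCoord O R D.center)
    have hw' := vertices_conj hw₁ hw₂ hw₃ hw
    choose p hp using fun i => D.unitCoord_surjective (O := O) hR (![w₁, w₂, w₃] i)
    have hw1 : ∀ i, ‖![w₁, w₂, w₃] i‖ = 1 := by
      intro i; fin_cases i <;> assumption
    obtain ⟨s, hs, hsp⟩ := exists_triangle_circumsphere t.circumsphere (p := p)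
      (fun i => by
        have := D.norm_unitCoord (p i) hR (O := O)
        rw [hp, hw1, eq_comm, div_eq_one_iff_eq hR.ne'] at this
        exact this)
      (fun h => h₁₂ ((hp 0).symm.trans (h ▸ hp 1)))
      (fun h => h₁₃ ((hp 0).symm.trans (h ▸ hp 2)))
      (fun h => h₂₃ ((hp 1).symm.trans (h ▸ hp 2)))
    have hsz : ∀ i, D.unitCoord O R (s.points i) = ![w₁, w₂, w₃] i := fun i => by rw [hsp, hp]
    have hsD : D.IsCircumscribed asym s := by
      rw [D.isCircumscribed_iff_chordForm asym hR s hsz hw1]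
      refine ⟨?_, has.imp_right hnd⟩
      have h01 := chordForm_mul_of_vertices hw hw'
      have h02 := chordForm_mul_of_vertices (f₁ := D.unitCoord O R D.focusPos)
        (f₂ := D.unitCoord O R D.focusNeg) (z₁ := w₁) (z₂ := w₃) (z₃ := w₂)
        (by linear_combination hw) (by linear_combination hw')
      have h12 := chordForm_mul_of_vertices (f₁ := D.unitCoord O R D.focusPos)
        (f₂ := D.unitCoord O R D.focusNeg) (z₁ := w₂) (z₂ := w₃) (z₃ := w₁)
        (by linear_combination hw) (by linear_combination hw')
      rw [← hβ] at h01 h02 h12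
      intro i j hij
      fin_cases i <;> fin_cases j <;> first
        | exact absurd hij (by decide)
        | assumption
    obtain ⟨z', hz', -, -, hsum', -⟩ := hrel s hs hsD
    have hzz : z' = ![w₁, w₂, w₃] := funext fun i => (hz' i).symm.trans (hsz i)
    rw [hk s hs hsD, ← hk t rfl ht, hsum, hzz] at hsum'
    apply hnorm
    have : ‖z 0 + z 1 + z 2‖ ^ 2 = ‖w₁ + w₂ + w₃‖ ^ 2 := by simpa using hsum'
    exact ((pow_left_inj₀ (norm_nonneg _) (norm_nonneg _) two_ne_zero).1 this).symm
  · rintro (h | h)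
    -- Here `F = 0`, and the vertex sum `conj E * l` has norm `‖E‖`; in the other case `E = 0` and
    -- the vertex sum is `F`.
    · refine ⟨(9 - ‖D.unitCoord O R D.focusPos * D.unitCoord O R D.focusNeg‖ ^ 2) / 4, ?_⟩
      intro s hs hD
      obtain ⟨z, -, hz1, -, hsum, hv⟩ := hrel s hs hD
      rw [hsum, hv, h]
      simp [hz1]
    · refine ⟨(9 - ‖D.unitCoord O R D.focusPos + D.unitCoord O R D.focusNeg‖ ^ 2) / 4, ?_⟩
      intro s hs hD
      obtain ⟨z, -, hz1, -, hsum, hv⟩ := hrel s hs hD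
      rw [hsum, hv, h]
      simp
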